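/- Let $\Omega$ be a set and let $G\le \mathrm{Sym}(\Omega)$ be an infinite primitive permutation group with a finite point stabilizer $G_\alpha$, where $\alpha\in\Omega$. Then $G$ is generated by finitely many elements of finite order and has a unique (non-trivial) minimal normal subgroup $M$. There are an infinite, non-abelian, finitely generated simple group $K$ and a finite integer $m\ge 1$ such that $M=K_1\times\cdots\times K_m$ with $K_i\cong K$ for $1\le i\le m$ (that is, $M\cong K^m$). Moreover, exactly one of the following holds: (1) $M$ acts regularly on $\Omega$, and $G$ is the split extension $M\rtimes G_\alpha$, with no non-identity element of $G_\alpha$ inducing (by conjugation) an inner automorphism of $M$; (2) $M$ is simple and acts non-regularly on $\Omega$, $M$ has finite index in $G$, and $M\le G\le \mathrm{Aut}(M)$, i.e. the conjugation action embeds $G$ in $\mathrm{Aut}(M)$ (so $G$ is almost simple); (3) $M$ is non-regular and non-simple, $m>1$, and $G$ is permutation isomorphic to a subgroup of the wreath product $H\,\mathrm{Wr}_{\Delta}\,\mathrm{Sym}(\Delta)$, $\Delta=\{1,\dots,m\}$, acting in the product action on $\Gamma^m$, where $\Gamma$ is some infinite set and $H\le\mathrm{Sym}(\Gamma)$ is an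 infinite primitive permutation group with a finite point stabilizer that is of type (2), and whose unique minimal normal subgroup is isomorphic to $K$. -/

import Mathlib

universe u

/-- A minimal normal subgroup of `G`: a non-trivial normal subgroup that does not properly
contain any other non-trivial normal subgroup of `G`. -/
structure IsMinimalNormal {G : Type*} [Group G] (M : Subgroup G) : Prop where
  normal : M.Normal
  ne_bot : M ≠ ⊥
  eq_of_le : ∀ N : Subgroup G, N.Normal → N ≠ ⊥ → N ≤ M → N = M

/-- `M` is the unique minimal normal subgroup of `G`. -/
def IsUniqueMinimalNormal {G : Type*} [Group G] (M : Subgroup G) : Prop :=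
  IsMinimalNormal M ∧ ∀ N : Subgroup G, IsMinimalNormal N → N = M

/-- The group `G` acts regularly on `X`: transitively, with all point stabilizers trivial. -/
def ActsRegularly (G X : Type*) [Group G] [MulAction G X] : Prop :=
  MulAction.IsPretransitive G X ∧ ∀ x : X, MulAction.stabilizer G x = ⊥

/-- The group `G` is non-abelian. -/
def IsNonabelian (G : Type*) [Group G] : Prop :=
  ∃ a b : G, a * b ≠ b * a

/-- `G` is almost simple over its subgroup `M`: `M` is a normal non-abelian simple subgroup and
`M ≤ G ≤ Aut(M)`, that is, the conjugation action of `G` on `M` embeds `G` in `Aut(M)`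
(with `M` being carried to the inner automorphisms). -/
structure IsAlmostSimpleOver {G : Type*} [Group G] (M : Subgroup G) : Prop where
  normal : M.Normal
  simple : IsSimpleGroup M
  nonabelian : IsNonabelian M
  embeds : ∃ φ : G →* MulAut M, Function.Injective φ ∧
    ∀ (g : G) (x : M), ((φ g x : M) : G) = g * (x : G) * g⁻¹

/-- The (unrestricted) wreath product `H Wr_Δ Sym(Δ)`: the semidirect product of the base group
`Δ → H` by `Sym(Δ)`, which permutes the coordinates. -/
abbrev WreathProduct (H Δ : Type*) [Group H] : Type _ :=
  (Δ → H) ⋊[mulAutArrow (G := Equiv.Perm Δ) (A := Δ) (M := H)] Equiv.Perm Δ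

/-- The product action of `H Wr_Δ Sym(Δ)` on `Δ → Γ`: the base group acts coordinatewise and
`Sym(Δ)` permutes the coordinates. -/
instance WreathProduct.productAction (H Δ Γ : Type*) [Group H] [MulAction H Γ] :
    MulAction (WreathProduct H Δ) (Δ → Γ) where
  smul w f := fun i => w.left i • f (w.right⁻¹ i)
  one_smul f := by
    funext i
    change (1 : H) • f ((1 : Equiv.Perm Δ)⁻¹ i) = f i
    simp
  mul_smul v w f := by
    funext i
    change (v.left i * w.left (v.right⁻¹ i)) • f ((v.right * w.right)⁻¹ i) =
      v.left i • w.left (v.right⁻¹ i) • f (w.right⁻¹ (v.right⁻¹ i))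
    rw [mul_smul, mul_inv_rev, Equiv.Perm.mul_apply]

/-- Two group actions are permutation isomorphic: there are a group isomorphism and a bijection
of the underlying sets that intertwine the actions. -/
def PermutationIsomorphic (G X S Y : Type*) [Group G] [MulAction G X] [Group S] [MulAction S Y] :
    Prop :=
  ∃ (φ : G ≃* S) (e : X ≃ Y), ∀ (g : G) (x : X), e (g • x) = φ g • e x

/-- `G ≤ Sym(Ω)` is an infinite primitive group with a finite point stabilizer. -/
structure IsInfinitePrimitiveWithFiniteStabilizer {Ω : Type*} (G : Subgroup (Equiv.Perm Ω)) :
    Prop where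
  infinite : Infinite G
  primitive : MulAction.IsPreprimitive G Ω
  finite_stabilizer : ∃ α : Ω, Finite (MulAction.stabilizer G α)

/-- Split extension type: `M` acts regularly on `Ω`, `G` is the internal semidirect product of
the normal subgroup `M` and `G_α`, and no non-identity element of `G_α` induces an inner
automorphism of `M`. -/
structure IsSplitExtensionType {Ω : Type*} (G : Subgroup (Equiv.Perm Ω)) (M : Subgroup G)
    (α : Ω) : Prop where
  regular : ActsRegularly M Ω
  normal : M.Normal
  split : Subgroup.IsComplement' M (MulAction.stabilizer G α)
  not_inner : ∀ g ∈ MulAction.stabilizer G α,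
    (∃ x : M, ∀ y : M, g * (y : G) * g⁻¹ = (x : G) * (y : G) * (x : G)⁻¹) → g = 1

/-- Almost simple type: `M` is simple and acts non-regularly on `Ω`, it has finite index in `G`,
and `M ≤ G ≤ Aut(M)`. -/
structure IsAlmostSimpleType {Ω : Type*} (G : Subgroup (Equiv.Perm Ω)) (M : Subgroup G) :
    Prop where
  simple : IsSimpleGroup M
  not_regular : ¬ ActsRegularly M Ω
  finiteIndex : M.FiniteIndex
  almostSimple : IsAlmostSimpleOver M

/-- Product action type: `M` is neither regular nor simple, `m > 1`, and `G` is permutation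
isomorphic to a subgroup of `H Wr Sym(m)` in its product action on `Γ ^ m`, where `H ≤ Sym(Γ)` is
an infinite primitive group with a finite point stabilizer, of almost simple type, whose unique
minimal normal subgroup is isomorphic to `K`. -/
structure IsProductActionType {Ω : Type u} (G : Subgroup (Equiv.Perm Ω)) (M : Subgroup G)
    (K : Type u) [Group K] (m : ℕ) : Prop where
  not_regular : ¬ ActsRegularly M Ω
  not_simple : ¬ IsSimpleGroup M
  one_lt : 1 < m
  embeds : ∃ (Γ : Type u) (H : Subgroup (Equiv.Perm Γ)) (L : Subgroup H),
    Infinite Γ ∧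
    IsInfinitePrimitiveWithFiniteStabilizer H ∧
    IsUniqueMinimalNormal L ∧
    IsAlmostSimpleType H L ∧
    Nonempty (L ≃* K) ∧
    ∃ S : Subgroup (WreathProduct H (Fin m)), PermutationIsomorphic G Ω S (Fin m → Γ)

/-- Exactly one of three propositions holds. -/
def ExactlyOne (a b c : Prop) : Prop :=
  (a ∨ b ∨ c) ∧ ¬ (a ∧ b) ∧ ¬ (a ∧ c) ∧ ¬ (b ∧ c)

/-! A non-trivial normal subgroup of `G` is transitive, so it supplements `G_α` and has index at
most `|G_α|`. Intersections of two such subgroups have finite index in the infinite group `G`, hence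
are non-trivial; one of maximal index is therefore the least non-trivial normal subgroup `M`
(`exists_least_normal`).

`M` is finitely generated, infinite and characteristically simple, hence non-abelian. It has a
maximal normal subgroup `N`, with finitely many `G`-conjugates. Their intersection is normal in `G`,
so trivial, and a Chinese remainder argument gives `M ≅ (M/N)^m` (`pi_conjQuotient_injective`,
`pi_conjQuotient_surjective`).

If `M` is neither regular nor simple, let `P` be the stabilizer of `N` under conjugation and `A =
G_α ∩ P`. The action of `P` on the cosets of `NA` gives `H ≤ Sym(Γ)`, and induction from `P` maps
`G` into `H Wr Sym(m)`. Here `G_α` fixes a constant point and `M` is transitive on `Γ^m`, so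
primitivity identifies `Ω` with `Γ^m` (`exists_productAction`). -/

section FiniteStabilizer

/-! ### Normal subgroups and generation under finite point stabilizers -/

variable {G Ω : Type*} [Group G] [MulAction G Ω]

theorem FaithfulSMul.infinite_of_infinite_group (G Ω : Type*) [Group G] [MulAction G Ω]
    [FaithfulSMul G Ω] [Infinite G] : Infinite Ω := by
  by_contra h
  rw [not_infinite_iff_finite] at h
  have : Finite G := Finite.of_injective _ (MulAction.toPerm_injective (α := G) (β := Ω))
  exact not_finite G

theorem Subgroup.isPretransitive_of_normal_of_ne_bot [FaithfulSMul G Ω]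
    [MulAction.IsPreprimitive G Ω] (N : Subgroup G) [N.Normal] (hN : N ≠ ⊥) :
    MulAction.IsPretransitive N Ω := by
  refine MulAction.IsQuasiPreprimitive.isPretransitive_of_normal (G := G) fun h => hN ?_
  rw [Subgroup.eq_bot_iff_forall]
  intro x hx
  refine FaithfulSMul.eq_of_smul_eq_smul (α := Ω) fun a => ?_
  have ha : a ∈ MulAction.fixedPoints N Ω := h ▸ Set.mem_univ a
  rw [one_smul]
  exact ha ⟨x, hx⟩

theorem Subgroup.exists_mul_mem_stabilizer (N : Subgroup G) [MulAction.IsPretransitive N Ω]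
    (α : Ω) (g : G) : ∃ x ∈ N, ∃ a ∈ MulAction.stabilizer G α, g = x * a := by
  obtain ⟨⟨x, hx⟩, h⟩ := MulAction.exists_smul_eq N α (g • α)
  refine ⟨x, hx, x⁻¹ * g, ?_, by group⟩
  rw [MulAction.mem_stabilizer_iff, mul_smul, inv_smul_eq_iff]
  exact h.symm

theorem Subgroup.stabilizer_quotient_surjective (N : Subgroup G) [N.Normal]
    [MulAction.IsPretransitive N Ω] (α : Ω) :
    Function.Surjective fun a : MulAction.stabilizer G α => ((a : G) : G ⧸ N) := by
  intro q
  obtain ⟨g, rfl⟩ := QuotientGroup.mk_surjective q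
  obtain ⟨x, hx, a, ha, rfl⟩ := N.exists_mul_mem_stabilizer α g
  refine ⟨⟨a, ha⟩, ?_⟩
  rw [QuotientGroup.mk_mul, (QuotientGroup.eq_one_iff x).2 hx, one_mul]

theorem Subgroup.finiteIndex_of_isPretransitive (N : Subgroup G) [N.Normal]
    [MulAction.IsPretransitive N Ω] (α : Ω) [Finite (MulAction.stabilizer G α)] :
    N.FiniteIndex :=
  have : Finite (G ⧸ N) := Finite.of_surjective _ (N.stabilizer_quotient_surjective α)
  Subgroup.finiteIndex_of_finite_quotient

theorem Subgroup.index_le_card_stabilizer (N : Subgroup G) [N.Normal]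
    [MulAction.IsPretransitive N Ω] (α : Ω) [Finite (MulAction.stabilizer G α)] :
    N.index ≤ Nat.card (MulAction.stabilizer G α) :=
  Nat.card_le_card_of_surjective _ (N.stabilizer_quotient_surjective α)

variable [FaithfulSMul G Ω] [MulAction.IsPreprimitive G Ω] [Infinite G]

/-- An infinite primitive group with a finite point stabilizer has a least nontrivial normal
subgroup. -/
theorem exists_least_normal (α : Ω) [Finite (MulAction.stabilizer G α)] :
    ∃ M : Subgroup G, M.Normal ∧ M ≠ ⊥ ∧ ∀ N : Subgroup G, N.Normal → N ≠ ⊥ → M ≤ N := by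
  let c := Nat.card (MulAction.stabilizer G α)
  have hfi : ∀ N : Subgroup G, N.Normal → N ≠ ⊥ → N.FiniteIndex := fun N _ h =>
    have := N.isPretransitive_of_normal_of_ne_bot (Ω := Ω) h
    N.finiteIndex_of_isPretransitive α
  have hle : ∀ N : Subgroup G, N.Normal → N ≠ ⊥ → N.index ≤ c := fun N _ h =>
    have := N.isPretransitive_of_normal_of_ne_bot (Ω := Ω) h
    N.index_le_card_stabilizer α
  have hne : {N : Subgroup G | N.Normal ∧ N ≠ ⊥}.Nonempty :=
    ⟨⊤, inferInstance, top_ne_bot⟩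
  -- Minimizing `c - index` maximizes the index; the truncated subtraction is harmless because all
  -- these indices are at most `c`.
  obtain ⟨M, ⟨hM, hM'⟩, hmin⟩ := WellFounded.has_min
    (measure fun N : Subgroup G => c - N.index).wf _ hne
  refine ⟨M, hM, hM', fun N hN hN' => ?_⟩
  have := hfi M hM hM'
  have := hfi N hN hN'
  have hI : M ⊓ N ≠ ⊥ := by
    intro h
    have : (⊥ : Subgroup G).FiniteIndex := h ▸ inferInstance
    have : Finite (G ⧸ (⊥ : Subgroup G)) := Subgroup.finite_quotient_of_finiteIndex
    have := Finite.of_equiv _ (QuotientGroup.quotientBot (G := G)).toEquiv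
    exact not_finite G
  by_contra hlt
  have hlt' : M ⊓ N < M := lt_of_le_of_ne inf_le_left fun h => hlt (h ▸ inf_le_right)
  have h1 := Subgroup.index_strictAnti hlt'
  have h2 := hle _ inferInstance hI
  exact hmin (M ⊓ N) ⟨inferInstance, hI⟩ (by
    change c - _ < c - _
    omega)

/-- Otherwise every non-trivial element would generate the group, which fails for the square of a
generator of an infinite cyclic group. This excludes trivial point stabilizers. -/
theorem not_isCoatom_bot_of_infinite (G : Type*) [Group G] [Infinite G] :
    ¬ IsCoatom (⊥ : Subgroup G) := by
  intro h
  obtain ⟨g, hg⟩ := exists_ne (1 : G)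
  have key : ∀ x : G, x ≠ 1 → Subgroup.zpowers x = ⊤ := fun x hx =>
    h.2 _ (bot_lt_iff_ne_bot.2 fun h => hx (Subgroup.zpowers_eq_bot.1 h))
  have hinf : ¬ IsOfFinOrder g := by
    intro hf
    have : Finite (Subgroup.zpowers g) := hf.finite_zpowers
    rw [key g hg] at this
    have := Finite.of_equiv _ (Subgroup.topEquiv (G := G)).toEquiv
    exact not_finite G
  have hinj := injective_zpow_iff_not_isOfFinOrder.2 hinf
  have h2 : g ^ (2 : ℤ) ≠ 1 := fun h => by
    have := hinj (h.trans (zpow_zero g).symm)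
    omega
  have : g ∈ Subgroup.zpowers (g ^ (2 : ℤ)) := key _ h2 ▸ Subgroup.mem_top g
  obtain ⟨k, hk⟩ := Subgroup.mem_zpowers_iff.1 this
  rw [← zpow_mul] at hk
  have := hinj (hk.trans (zpow_one g).symm)
  omega

/-- Two distinct point stabilizers are finite maximal subgroups, so their union generates. If all
stabilizers coincided, faithfulness would make them trivial, and a trivial subgroup is not maximal
here. -/
theorem exists_finset_isOfFinOrder_closure_eq_top (α : Ω)
    [Finite (MulAction.stabilizer G α)] :
    ∃ S : Finset G, (∀ s ∈ S, IsOfFinOrder s) ∧ Subgroup.closure (S : Set G) = ⊤ := by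
  classical
  have := FaithfulSMul.infinite_of_infinite_group G Ω
  have hco : ∀ β : Ω, IsCoatom (MulAction.stabilizer G β) := fun β =>
    MulAction.IsPreprimitive.isCoatom_stabilizer_of_isPreprimitive G β
  have hfin : ∀ β : Ω, Finite (MulAction.stabilizer G β) := fun β => by
    obtain ⟨g, rfl⟩ := MulAction.exists_smul_eq G α β
    exact Finite.of_equiv _ (MulAction.stabilizerEquivStabilizer (g := g) rfl).toEquiv
  obtain ⟨β, hβ⟩ : ∃ β : Ω, ¬ MulAction.stabilizer G β ≤ MulAction.stabilizer G α := by
    by_contra! h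
    have heq : ∀ β, MulAction.stabilizer G β = MulAction.stabilizer G α := fun β =>
      ((hco β).le_iff_eq (hco α).1).1 (h β) |>.symm
    have hbot : MulAction.stabilizer G α = ⊥ := by
      rw [Subgroup.eq_bot_iff_forall]
      intro x hx
      refine FaithfulSMul.eq_of_smul_eq_smul (α := Ω) fun b => ?_
      rw [one_smul]
      rw [← heq b] at hx
      exact hx
    exact not_isCoatom_bot_of_infinite G (hbot ▸ hco α)
  have hfo : ∀ γ : Ω, ∀ s ∈ MulAction.stabilizer G γ, IsOfFinOrder s := fun γ s hs => by
    have := hfin γ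
    exact Submonoid.isOfFinOrder_coe.2 (isOfFinOrder_of_finite (⟨s, hs⟩ : MulAction.stabilizer G γ))
  have hA : (MulAction.stabilizer G α : Set G).Finite := hfin α
  have hB : (MulAction.stabilizer G β : Set G).Finite := hfin β
  refine ⟨(hA.union hB).toFinset, fun s hs => ?_, ?_⟩
  · rw [Set.Finite.mem_toFinset] at hs
    exact hs.elim (hfo α s) (hfo β s)
  · rw [Set.Finite.coe_toFinset, Subgroup.closure_union, Subgroup.closure_eq, Subgroup.closure_eq]
    exact (hco α).2 _ (left_lt_sup.2 hβ)

end FiniteStabilizer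

/-! ### Consequences of a least normal subgroup -/

section LeastNormal

variable {G : Type*} [Group G]

theorem isUniqueMinimalNormal_of_least {M : Subgroup G} (hM : M.Normal) (hM' : M ≠ ⊥)
    (h : ∀ N : Subgroup G, N.Normal → N ≠ ⊥ → M ≤ N) : IsUniqueMinimalNormal M :=
  ⟨⟨hM, hM', fun N hN hN' hle => le_antisymm hle (h N hN hN')⟩,
    fun N hN => (hN.eq_of_le M hM hM' (h N hN.normal hN.ne_bot)).symm⟩

/-- A non-trivial kernel would contain `M`, making `M` abelian. -/
theorem conjNormal_injective_of_least {M : Subgroup G} [M.Normal]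
    (h : ∀ N : Subgroup G, N.Normal → N ≠ ⊥ → M ≤ N) (hna : IsNonabelian M) :
    Function.Injective (MulAut.conjNormal : G →* MulAut M) := by
  rw [← MonoidHom.ker_eq_bot_iff]
  by_contra hne
  obtain ⟨a, b, hab⟩ := hna
  have ha : (a : G) ∈ (MulAut.conjNormal : G →* MulAut M).ker := h _ inferInstance hne a.2
  rw [MonoidHom.mem_ker] at ha
  have h1 := congrArg (fun x : M => (x : G)) (DFunLike.congr_fun ha b)
  simp only [MulAut.conjNormal_apply, MulAut.one_apply] at h1
  exact hab (Subtype.ext (by simpa using mul_inv_eq_iff_eq_mul.1 h1))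

theorem eq_bot_or_eq_top_of_characteristic_of_least {M : Subgroup G} [M.Normal]
    (h : ∀ N : Subgroup G, N.Normal → N ≠ ⊥ → M ≤ N) (C : Subgroup M) [C.Characteristic] :
    C = ⊥ ∨ C = ⊤ := by
  refine or_iff_not_imp_left.2 fun hC => ?_
  have h1 : M ≤ C.map M.subtype := h _ inferInstance fun h0 =>
    hC ((Subgroup.map_eq_bot_iff_of_injective _ M.subtype_injective).1 h0)
  rw [eq_top_iff]
  intro x _
  obtain ⟨y, hy, hxy⟩ := h1 x.2
  rwa [← Subtype.ext hxy]

end LeastNormal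

/-- An infinite finitely generated commutative group has a characteristic subgroup that is
neither trivial nor the whole group. -/
theorem CommGroup.exists_characteristic_ne (A : Type*) [CommGroup A] [Group.FG A] [Infinite A] :
    ∃ C : Subgroup A, C.Characteristic ∧ C ≠ ⊥ ∧ C ≠ ⊤ := by
  -- The subgroup of squares: were it trivial or everything, the group would be torsion and finitely
  -- generated, hence finite.
  refine ⟨(powMonoidHom 2 : A →* A).range, ?_, ?_, ?_⟩
  · rw [Subgroup.characteristic_iff_map_le]
    rintro φ _ ⟨_, ⟨x, rfl⟩, rfl⟩
    exact ⟨φ x, by simp⟩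
  · intro h
    have : IsMulTorsion A := fun x => isOfFinOrder_iff_pow_eq_one.2 ⟨2, two_pos, by
      have : (powMonoidHom 2 : A →* A) x ∈ (⊥ : Subgroup A) := h ▸ ⟨x, rfl⟩
      simpa using this⟩
    have := CommGroup.finite_of_fg_isMulTorsion A this
    exact not_finite A
  · intro h
    have hfin : Module.Finite ℤ (Additive A) := Module.Finite.iff_addGroup_fg.2 inferInstance
    -- Nakayama's lemma for `A = 2A`: some `r ≡ 1` modulo 2 kills `A`, and being odd it is non-zero.
    obtain ⟨r, hr, hr'⟩ := Submodule.exists_sub_one_mem_and_smul_eq_zero_of_fg_of_le_smul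
      (Ideal.span {(2 : ℤ)}) (⊤ : Submodule ℤ (Additive A)) hfin.1 (by
        intro x _
        have hx : Additive.toMul x ∈ (powMonoidHom 2 : A →* A).range := h ▸ Subgroup.mem_top _
        obtain ⟨y, hy⟩ := hx
        have : x = (2 : ℤ) • Additive.ofMul y := by
          apply Additive.toMul.injective
          rw [← hy]
          simp
        rw [this]
        exact Submodule.smul_mem_smul (Ideal.mem_span_singleton_self _) trivial)
    have hr0 : r ≠ 0 := by
      rintro rfl
      rw [Ideal.mem_span_singleton] at hr
      omega
    have : IsMulTorsion A := fun x => isOfFinOrder_iff_zpow_eq_one.2 ⟨r, hr0, by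
      have := hr' (Additive.ofMul x) trivial
      rwa [← ofMul_zpow, ofMul_eq_zero] at this⟩
    have := CommGroup.finite_of_fg_isMulTorsion A this
    exact not_finite A

theorem isNonabelian_of_least {G : Type*} [Group G] {M : Subgroup G} [M.Normal]
    [Group.FG M] [Infinite M] (h : ∀ N : Subgroup G, N.Normal → N ≠ ⊥ → M ≤ N) :
    IsNonabelian M := by
  by_contra hna
  have hcomm : ∀ a b : M, a * b = b * a := by
    intro a b
    by_contra hab
    exact hna ⟨a, b, hab⟩
  let _ : CommGroup M := { mul_comm := hcomm }
  obtain ⟨C, hC, h1, h2⟩ := CommGroup.exists_characteristic_ne M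
  exact (eq_bot_or_eq_top_of_characteristic_of_least h C).elim h1 h2

/-- A nontrivial finitely generated group has a simple quotient. -/
theorem exists_normal_isSimpleGroup_quotient (M : Type*) [Group M] [Group.FG M] [Nontrivial M] :
    ∃ (N : Subgroup M) (_ : N.Normal), IsSimpleGroup (M ⧸ N) := by
  obtain ⟨S, hS⟩ := Group.fg_iff.1 ‹Group.FG M›
  obtain ⟨N, -, hN⟩ := zorn_le_nonempty₀ {N : Subgroup M | N.Normal ∧ N ≠ ⊤} (by
    intro c hc hchain N₀ hN₀
    have hdir := hchain.directedOn
    refine ⟨sSup c, ⟨⟨fun n hn g => ?_⟩, fun htop => ?_⟩, fun _ => le_sSup⟩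
    · obtain ⟨N, hN, hn⟩ := (Subgroup.mem_sSup_of_directedOn ⟨N₀, hN₀⟩ hdir).1 hn
      exact (Subgroup.mem_sSup_of_directedOn ⟨N₀, hN₀⟩ hdir).2 ⟨N, hN, (hc hN).1.conj_mem n hn g⟩
    · have hex : ∀ t : Set M, t.Finite → ∃ N ∈ c, t ⊆ N := by
        intro t ht
        induction t, ht using Set.Finite.induction_on with
        | empty => exact ⟨N₀, hN₀, Set.empty_subset _⟩
        | @insert a s _ _ ih =>
          obtain ⟨N, hN, hs⟩ := ih
          obtain ⟨N', hN', ha⟩ := (Subgroup.mem_sSup_of_directedOn ⟨N₀, hN₀⟩ hdir).1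
            (htop ▸ Subgroup.mem_top a)
          obtain ⟨N'', hN'', h1, h2⟩ := hdir N hN N' hN'
          exact ⟨N'', hN'', Set.insert_subset (h2 ha) (hs.trans h1)⟩
      obtain ⟨N, hN, hSN⟩ := hex S hS.2
      refine (hc hN).2 (top_le_iff.1 ?_)
      rw [← hS.1]
      exact (Subgroup.closure_le N).2 hSN) ⊥ ⟨inferInstance, bot_ne_top⟩
  have hNn : N.Normal := hN.prop.1
  refine ⟨N, hNn, ?_⟩
  have : Nontrivial (M ⧸ N) := QuotientGroup.nontrivial_iff.2 hN.prop.2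
  refine ⟨fun H hH => ?_⟩
  by_cases htop : H.comap (QuotientGroup.mk' N) = ⊤
  · right
    rw [← Subgroup.map_comap_eq_self_of_surjective (QuotientGroup.mk'_surjective N) H, htop,
      Subgroup.map_top_of_surjective _ (QuotientGroup.mk'_surjective N)]
  · left
    have h1 : H.comap (QuotientGroup.mk' N) ≤ N :=
      hN.le_of_ge ⟨inferInstance, htop⟩ fun x hx => by
        have : (QuotientGroup.mk' N) x = 1 := (QuotientGroup.eq_one_iff x).2 hx
        rw [Subgroup.mem_comap, this]
        exact one_mem _
    rw [Subgroup.eq_bot_iff_forall]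
    intro x hx
    obtain ⟨y, rfl⟩ := QuotientGroup.mk'_surjective N x
    exact (QuotientGroup.eq_one_iff y).2 (h1 hx)

/-! ### Chinese remainder theorem for non-abelian simple quotients -/

section SimpleQuotients

variable {M K : Type*} [Group M] [Group K] [IsSimpleGroup K]

theorem Subgroup.map_eq_top_of_not_le_ker {π : M →* K} (hπ : Function.Surjective π)
    (A : Subgroup M) [hA : A.Normal] (h : ¬ A ≤ π.ker) : A.map π = ⊤ :=
  (IsSimpleGroup.eq_bot_or_eq_top_of_normal _ (hA.map π hπ)).resolve_left fun h0 =>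
    h ((Subgroup.map_eq_bot_iff A).1 h0)

/-- Commutators of elements of `A` with elements of `B` lie in `A ⊓ B`, while both subgroups map
onto the non-abelian group `K`. -/
theorem not_inf_le_ker (hK : IsNonabelian K) {π : M →* K} (hπ : Function.Surjective π)
    (A B : Subgroup M) [hA : A.Normal] [hB : B.Normal] (h1 : ¬ A ≤ π.ker) (h2 : ¬ B ≤ π.ker) :
    ¬ A ⊓ B ≤ π.ker := by
  intro h
  obtain ⟨a, b, hab⟩ := hK
  obtain ⟨x, hx, rfl⟩ : a ∈ A.map π := A.map_eq_top_of_not_le_ker hπ h1 ▸ Subgroup.mem_top a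
  obtain ⟨y, hy, rfl⟩ : b ∈ B.map π := B.map_eq_top_of_not_le_ker hπ h2 ▸ Subgroup.mem_top b
  have hm : x * y * x⁻¹ * y⁻¹ ∈ A ⊓ B := by
    refine ⟨?_, B.mul_mem (hB.conj_mem y hy x) (B.inv_mem hy)⟩
    have := A.mul_mem hx (hA.conj_mem _ (A.inv_mem hx) y)
    simpa [mul_assoc] using this
  have h3 := h hm
  rw [MonoidHom.mem_ker] at h3
  simp only [map_mul, map_inv] at h3
  apply hab
  rwa [mul_inv_eq_one, mul_inv_eq_iff_eq_mul] at h3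

/-- The Chinese remainder theorem for homomorphisms to a nonabelian simple group. -/
theorem MonoidHom.pi_surjective_of_isSimpleGroup (hK : IsNonabelian K) {ι : Type*} [Finite ι]
    (π : ι → M →* K) (hπ : ∀ i, Function.Surjective (π i))
    (hker : ∀ i j, (π i).ker ≤ (π j).ker → i = j) :
    Function.Surjective (MonoidHom.pi π) := by
  classical
  have := Fintype.ofFinite ι
  -- The intersection of the other kernels then maps onto the `i`-th factor, so the range contains
  -- every vector supported at one coordinate.
  have key : ∀ (i : ι) (s : Finset ι), i ∉ s →
      (s.inf fun j => (π j).ker).Normal ∧ ¬ (s.inf fun j => (π j).ker) ≤ (π i).ker := by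
    intro i s
    induction s using Finset.induction_on with
    | empty =>
      refine fun _ => ⟨by rw [Finset.inf_empty]; infer_instance, fun h => ?_⟩
      rw [Finset.inf_empty] at h
      obtain ⟨k, hk⟩ := exists_ne (1 : K)
      obtain ⟨x, rfl⟩ := hπ i k
      exact hk (h (Subgroup.mem_top x))
    | insert j s _ ih =>
      intro hi
      rw [Finset.mem_insert, not_or] at hi
      obtain ⟨h1, h2⟩ := ih hi.2
      rw [Finset.inf_insert]
      exact ⟨inferInstance, not_inf_le_ker hK (hπ i) _ _ (fun h => hi.1 (hker _ _ h).symm) h2⟩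
  rw [← MonoidHom.range_eq_top, eq_top_iff]
  intro k _
  refine Subgroup.pi_mem_of_mulSingle_mem k fun i => ?_
  obtain ⟨h1, h2⟩ := key i (Finset.univ.erase i) (Finset.notMem_erase i _)
  obtain ⟨x, hx, hxk⟩ : k i ∈ Subgroup.map (π i) _ :=
    Subgroup.map_eq_top_of_not_le_ker (hπ i) _ h2 ▸ Subgroup.mem_top (k i)
  refine ⟨x, funext fun j => ?_⟩
  by_cases hj : j = i
  · subst hj
    simpa using hxk
  · rw [Pi.mulSingle_eq_of_ne hj]
    exact (Finset.inf_le (f := fun j => (π j).ker)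
      (Finset.mem_erase.2 ⟨hj, Finset.mem_univ j⟩)) hx

end SimpleQuotients

/-! ### Product action and induced embedding -/

section WreathProduct

open scoped Pointwise

variable {H Δ Γ : Type*} [Group H] [MulAction H Γ]

theorem WreathProduct.smul_apply (w : WreathProduct H Δ) (f : Δ → Γ) (i : Δ) :
    (w • f) i = w.left i • f (w.right⁻¹ i) :=
  rfl

/-- If `w` keeps one point of the cube over `B` inside it, each base coordinate of `w` sends a point
of `B` into `B` and so preserves `B`. -/
theorem MulAction.IsBlock.wreathProduct_pi {B : Set Γ} (hB : MulAction.IsBlock H B) :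
    MulAction.IsBlock (WreathProduct H Δ) (Set.univ.pi fun _ : Δ => B) := by
  rw [MulAction.isBlock_iff_smul_eq_of_mem]
  intro w b hb hwb
  have key : ∀ i, w.left i • B = B := fun i =>
    hB.smul_eq_of_mem (hb (w.right⁻¹ i) trivial) (hwb i trivial)
  ext y
  constructor
  · rintro ⟨z, hz, rfl⟩ i -
    have := Set.smul_mem_smul_set (a := w.left i) (hz (w.right⁻¹ i) trivial)
    rwa [key i] at this
  · intro hy
    refine ⟨w⁻¹ • y, fun i _ => ?_, smul_inv_smul w y⟩
    have h1 := congrFun (smul_inv_smul w y) (w.right i)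
    rw [WreathProduct.smul_apply, Equiv.Perm.inv_def, Equiv.symm_apply_apply] at h1
    have h2 : w.left (w.right i) • (w⁻¹ • y) i ∈ w.left (w.right i) • B := by
      rw [h1, key]
      exact hy _ trivial
    exact Set.smul_mem_smul_set_iff.1 h2

variable {G : Type*} [Group G] (P : Subgroup G) {g : Δ → G}
  (hg : Function.Bijective fun i => (g i : G ⧸ P))

/-- The permutation of an indexed family of left coset representatives induced by left
multiplication. -/
noncomputable def cosetPerm : G →* Equiv.Perm Δ :=
  (Equiv.ofBijective _ hg).symm.permCongrHom.toMonoidHom.comp (MulAction.toPermHom G (G ⧸ P))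

theorem mk_cosetPerm (x : G) (i : Δ) :
    (g (cosetPerm P hg x i) : G ⧸ P) = ((x * g i : G) : G ⧸ P) :=
  (Equiv.ofBijective _ hg).apply_symm_apply (x • (g i : G ⧸ P))

theorem cosetPerm_eq_one {x : G} (h : ∀ i, (g i)⁻¹ * x * g i ∈ P) : cosetPerm P hg x = 1 := by
  ext i
  apply hg.1
  change (g (cosetPerm P hg x i) : G ⧸ P) = (g i : G ⧸ P)
  rw [mk_cosetPerm]
  symm
  rw [QuotientGroup.eq, ← mul_assoc]
  exact h i

theorem cosetPerm_cocycle_mem (x : G) (i : Δ) :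
    (g i)⁻¹ * x * g ((cosetPerm P hg x)⁻¹ i) ∈ P := by
  rw [mul_assoc, ← QuotientGroup.eq, ← mk_cosetPerm P hg, Equiv.Perm.inv_def, Equiv.apply_symm_apply]

/-- The induced embedding of `G` in a wreath product, determined by a homomorphism on a subgroup
and a family of left coset representatives. -/
noncomputable def wreathHom (ρ : P →* H) : G →* WreathProduct H Δ where
  toFun x := ⟨fun i => ρ ⟨_, cosetPerm_cocycle_mem P hg x i⟩, cosetPerm P hg x⟩
  map_one' := by
    refine SemidirectProduct.ext (funext fun i => ?_) (map_one _)
    change ρ _ = 1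
    rw [← map_one ρ]
    congr 1
    ext
    simp
  map_mul' x y := by
    refine SemidirectProduct.ext (funext fun i => ?_) (map_mul _ x y)
    change ρ _ = ρ _ * ρ _
    rw [← map_mul]
    congr 1
    ext
    simp [Equiv.Perm.smul_def, mul_assoc]

theorem wreathHom_smul_apply (ρ : P →* H) (x : G) (f : Δ → Γ) (i : Δ) :
    (wreathHom P hg ρ x • f) i =
      ρ ⟨_, cosetPerm_cocycle_mem P hg x i⟩ • f ((cosetPerm P hg x)⁻¹ i) :=
  rfl

/-- Elements all of whose conjugates by the representatives lie in `P` act coordinatewise. -/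
theorem wreathHom_smul_apply_of_conj_mem (ρ : P →* H) {x : G}
    (h : ∀ i, (g i)⁻¹ * x * g i ∈ P) (f : Δ → Γ) (i : Δ) :
    (wreathHom P hg ρ x • f) i = ρ ⟨_, h i⟩ • f i := by
  rw [wreathHom_smul_apply]
  simp only [cosetPerm_eq_one P hg h, inv_one, Equiv.Perm.coe_one, id_eq]

end WreathProduct

/-! ### Transferring primitivity along equivariant maps -/

section Equivariant

open scoped Pointwise

variable {G Ω W Y : Type*} [Group G] [MulAction G Ω] [Group W] [MulAction W Y]

/-- A primitive action is equivalent to any nontrivial action that is transitive and in which the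
point stabilizer fixes a point. -/
theorem MulAction.IsPreprimitive.exists_equivariant_equiv [MulAction.IsPreprimitive G Ω]
    [Nontrivial Y] (φ : G →* W) (α : Ω) (c : Y)
    (hstab : ∀ a ∈ MulAction.stabilizer G α, φ a • c = c) (hsurj : ∀ y, ∃ x : G, φ x • c = y) :
    ∃ e : Ω ≃ Y, ∀ (x : G) (ω : Ω), e (x • ω) = φ x • e ω := by
  choose t ht using MulAction.exists_smul_eq G α
  let f : Ω → Y := fun ω => φ (t ω) • c
  have hf : ∀ x : G, f (x • α) = φ x • c := fun x => by
    have h1 := hstab ((t (x • α))⁻¹ * x) (by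
      rw [MulAction.mem_stabilizer_iff, mul_smul, inv_smul_eq_iff, ht])
    rw [map_mul, map_inv, mul_smul, inv_smul_eq_iff] at h1
    exact h1.symm
  have heq : ∀ (x : G) (ω : Ω), f (x • ω) = φ x • f ω := fun x ω => by
    obtain ⟨y, rfl⟩ := MulAction.exists_smul_eq G α ω
    rw [← mul_smul, hf, hf, map_mul, mul_smul]
  have hfs : Function.Surjective f := fun y => by
    obtain ⟨x, rfl⟩ := hsurj y
    exact ⟨x • α, hf x⟩
  -- The fibres of `f` are blocks; none is all of `Ω`, since `f` is onto and `Y` is non-trivial.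
  have hfi : Function.Injective f := by
    intro a b hab
    have hB : MulAction.IsBlock G (f ⁻¹' {f a}) := by
      rw [MulAction.isBlock_iff_smul_eq_of_mem]
      intro x ω hω hxω
      rw [Set.mem_preimage, Set.mem_singleton_iff] at hω hxω
      rw [heq, hω] at hxω
      ext z
      rw [Set.mem_smul_set_iff_inv_smul_mem, Set.mem_preimage, Set.mem_preimage,
        Set.mem_singleton_iff, Set.mem_singleton_iff, heq, map_inv, inv_smul_eq_iff, hxω]
    rcases hB.subsingleton_or_eq_univ with h | h
    · exact h rfl hab.symm
    · obtain ⟨y, hy⟩ := exists_ne (f a)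
      obtain ⟨ω, rfl⟩ := hfs y
      exact (hy (h ▸ Set.mem_univ ω : ω ∈ f ⁻¹' {f a})).elim
  exact ⟨Equiv.ofBijective f ⟨hfi, hfs⟩, heq⟩

theorem exists_permutationIsomorphic [FaithfulSMul G Ω] (φ : G →* W) (e : Ω ≃ Y)
    (he : ∀ (x : G) (ω : Ω), e (x • ω) = φ x • e ω) :
    ∃ S : Subgroup W, PermutationIsomorphic G Ω S Y := by
  have hφ : Function.Injective φ := fun x y hxy =>
    FaithfulSMul.eq_of_smul_eq_smul (α := Ω) fun ω => e.injective (by rw [he, he, hxy])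
  exact ⟨φ.range, φ.ofInjective hφ, e, fun x ω => he x ω⟩

/-- If a primitive group embeds in a wreath product in product action, then the components are
primitive. -/
theorem MulAction.IsPreprimitive.of_wreathProduct {H Δ Γ : Type*} [Group H] [MulAction H Γ]
    [Nonempty Δ] [MulAction.IsPretransitive H Γ] [MulAction.IsPreprimitive G Ω]
    (φ : G →* WreathProduct H Δ) (e : Ω ≃ (Δ → Γ))
    (he : ∀ (x : G) (ω : Ω), e (x • ω) = φ x • e ω) : MulAction.IsPreprimitive H Γ := by
  refine ⟨fun {B} hB => ?_⟩
  have hB' := hB.wreathProduct_pi (Δ := Δ)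
  have hA : MulAction.IsBlock G (e ⁻¹' (Set.univ.pi fun _ : Δ => B)) := by
    rw [MulAction.isBlock_iff_smul_eq_of_mem] at hB' ⊢
    intro x ω hω hxω
    rw [Set.mem_preimage] at hω hxω
    rw [he] at hxω
    have h1 := hB' hω hxω
    ext z
    rw [Set.mem_smul_set_iff_inv_smul_mem, Set.mem_preimage, Set.mem_preimage, he, map_inv,
      ← Set.mem_smul_set_iff_inv_smul_mem, h1]
  rcases hA.subsingleton_or_eq_univ with h | h
  · left
    intro b hb b' hb'
    have h1 := h (x := e.symm fun _ => b) (by simpa using hb)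
      (y := e.symm fun _ => b') (by simpa using hb')
    exact congrFun (e.symm.injective h1) (Classical.arbitrary Δ)
  · right
    rw [Set.eq_univ_iff_forall] at h ⊢
    intro b
    have h1 := h (e.symm fun _ => b)
    rw [Set.mem_preimage, e.apply_symm_apply] at h1
    exact h1 (Classical.arbitrary Δ) trivial

end Equivariant

/-! ### Quotients by the conjugates of a normal subgroup -/

section ConjugateQuotients

open scoped Pointwise

variable {G : Type*} [Group G] {M : Subgroup G} [M.Normal]

/-- The elements of `G` whose conjugation action stabilizes a subgroup of a normal subgroup. -/
def conjStabilizer (N : Subgroup M) : Subgroup G :=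
  (MulAction.stabilizer (MulAut M) N).comap MulAut.conjNormal

theorem mem_conjStabilizer {N : Subgroup M} {x : G} :
    x ∈ conjStabilizer N ↔ (MulAut.conjNormal x : MulAut M) • N = N :=
  Iff.rfl

theorem le_conjStabilizer (N : Subgroup M) [hN : N.Normal] : M ≤ conjStabilizer N := by
  intro x hx
  rw [mem_conjStabilizer]
  ext y
  rw [Subgroup.mem_pointwise_smul_iff_inv_smul_mem, ← map_inv, MulAut.smul_def]
  have h : MulAut.conjNormal x⁻¹ y = (⟨x, hx⟩ : M)⁻¹ * y * (⟨x, hx⟩ : M) := by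
    ext
    simp
  rw [h]
  simpa using hN.mem_comm_iff (a := (⟨x, hx⟩ : M)⁻¹ * y) (b := ⟨x, hx⟩)

theorem conj_mem_map_iff_of_mem_conjStabilizer {N : Subgroup M} {x : G}
    (hx : x ∈ conjStabilizer N) (y : M) : MulAut.conjNormal x y ∈ N ↔ y ∈ N := by
  rw [mem_conjStabilizer] at hx
  conv_lhs => rw [← hx]
  exact Subgroup.smul_mem_pointwise_smul_iff

/-- The homomorphism to the quotient by a conjugate of `N`, identified with the quotient
by `N`. -/
def conjQuotient (N : Subgroup M) [N.Normal] (x : G) : M →* M ⧸ N :=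
  (QuotientGroup.mk' N).comp (MulAut.conjNormal x⁻¹ : MulAut M).toMonoidHom

variable (N : Subgroup M) [N.Normal]

theorem conjQuotient_apply (x : G) (y : M) :
    conjQuotient N x y = ((MulAut.conjNormal x⁻¹ y : M) : M ⧸ N) :=
  rfl

theorem conjQuotient_surjective (x : G) : Function.Surjective (conjQuotient N x) :=
  (QuotientGroup.mk'_surjective N).comp (MulAut.conjNormal x⁻¹ : MulAut M).surjective

theorem ker_conjQuotient (x : G) :
    (conjQuotient N x).ker = (MulAut.conjNormal x : MulAut M) • N := by
  ext y
  rw [MonoidHom.mem_ker, conjQuotient_apply, QuotientGroup.eq_one_iff,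
    Subgroup.mem_pointwise_smul_iff_inv_smul_mem, ← map_inv, MulAut.smul_def]

/-- `M` is normal and stabilizes `N`, so the `M`-part of a representative can be dropped. With `S =
G_α`, this is what later makes `G_α` fix a constant point of `Γ^m`. -/
theorem exists_conjStabilizer_representatives [M.FiniteIndex] (S : Subgroup G)
    (hS : ∀ x : G, ∃ y ∈ M, ∃ s ∈ S, x = y * s) :
    ∃ m : ℕ, 1 ≤ m ∧ ∃ g : Fin m → G, (∀ i, g i ∈ S) ∧
      Function.Bijective fun i => (g i : G ⧸ conjStabilizer N) := by
  have hfi : (conjStabilizer N).FiniteIndex := Subgroup.finiteIndex_of_le (le_conjStabilizer N)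
  have hfin : Finite (G ⧸ conjStabilizer N) := Subgroup.finite_quotient_of_finiteIndex
  have hrep : ∀ q : G ⧸ conjStabilizer N, ∃ s ∈ S, (s : G ⧸ conjStabilizer N) = q := by
    intro q
    obtain ⟨x, rfl⟩ := QuotientGroup.mk_surjective q
    obtain ⟨y, hy, s, hs, rfl⟩ := hS x
    refine ⟨s, hs, QuotientGroup.eq.2 (le_conjStabilizer N ?_)⟩
    have := ‹M.Normal›.conj_mem y hy s⁻¹
    simpa [mul_assoc] using this
  choose r hrS hr using hrep
  let e := Finite.equivFin (G ⧸ conjStabilizer N)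
  refine ⟨Nat.card (G ⧸ conjStabilizer N), Nat.card_pos, fun i => r (e.symm i),
    fun i => hrS _, ?_⟩
  simpa only [hr] using e.symm.bijective

variable {ι : Type*} {g : ι → G}

/-- The intersection `R` of all conjugates of `N` is normal in `G`; if non-trivial it would contain
`M`, although `N` is proper. -/
theorem pi_conjQuotient_injective [Nontrivial (M ⧸ N)]
    (hg : Function.Bijective fun i => (g i : G ⧸ conjStabilizer N))
    (hM : ∀ N : Subgroup G, N.Normal → N ≠ ⊥ → M ≤ N) :
    Function.Injective (MonoidHom.pi fun i => conjQuotient N (g i)) := by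
  let R : Subgroup M := ⨅ x : G, (conjQuotient N x).ker
  have hR : (R.map M.subtype).Normal := by
    refine ⟨?_⟩
    rintro _ ⟨y, hy, rfl⟩ z
    refine ⟨MulAut.conjNormal z y, ?_, by simp⟩
    simp only [R, SetLike.mem_coe, Subgroup.mem_iInf, MonoidHom.mem_ker] at hy ⊢
    intro x
    rw [← hy (z⁻¹ * x), conjQuotient_apply, conjQuotient_apply, mul_inv_rev, inv_inv, map_mul,
      MulAut.mul_apply]
  have hbot : R = ⊥ := by
    by_contra hne
    have hle : M ≤ R.map M.subtype := hM _ hR fun h =>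
      hne ((Subgroup.map_eq_bot_iff_of_injective _ M.subtype_injective).1 h)
    obtain ⟨q, hq⟩ := exists_ne (1 : M ⧸ N)
    obtain ⟨x, rfl⟩ := conjQuotient_surjective N 1 q
    obtain ⟨y, hy, hyx⟩ := hle x.2
    rw [Subtype.ext hyx] at hy
    simp only [R, SetLike.mem_coe, Subgroup.mem_iInf, MonoidHom.mem_ker] at hy
    exact hq (hy 1)
  rw [injective_iff_map_eq_one]
  intro x hx
  rw [← Subgroup.mem_bot, ← hbot]
  simp only [R, Subgroup.mem_iInf]
  intro z
  obtain ⟨i, hi⟩ := hg.2 z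
  have h1 : (conjQuotient N z).ker = (conjQuotient N (g i)).ker := by
    have h2 : (g i)⁻¹ * z ∈ conjStabilizer N := QuotientGroup.eq.1 hi
    rw [mem_conjStabilizer, map_mul, map_inv, mul_smul, inv_smul_eq_iff] at h2
    rw [ker_conjQuotient, ker_conjQuotient, h2]
  rw [h1]
  exact congrFun hx i

variable [IsSimpleGroup (M ⧸ N)]

theorem isNonabelian_quotient_of_least
    (hg : Function.Bijective fun i => (g i : G ⧸ conjStabilizer N))
    (hM : ∀ N : Subgroup G, N.Normal → N ≠ ⊥ → M ≤ N)
    (hna : IsNonabelian M) : IsNonabelian (M ⧸ N) := by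
  by_contra h
  obtain ⟨a, b, hab⟩ := hna
  refine hab (pi_conjQuotient_injective N hg hM (funext fun i => ?_))
  by_contra hne
  exact h ⟨conjQuotient N (g i) a, conjQuotient N (g i) b, by simpa using hne⟩

/-- Kernels of maps onto a simple group are maximal normal, so distinct conjugates of `N` are
incomparable, as the remainder theorem requires. -/
theorem MonoidHom.ker_le_ker_of_isSimpleGroup {M K : Type*} [Group M] [Group K] [IsSimpleGroup K]
    {π₁ π₂ : M →* K} (h₁ : Function.Surjective π₁) (h₂ : Function.Surjective π₂)
    (h : π₁.ker ≤ π₂.ker) : π₂.ker ≤ π₁.ker := by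
  by_contra hle
  obtain ⟨k, hk⟩ := exists_ne (1 : K)
  obtain ⟨x, rfl⟩ := h₂ k
  obtain ⟨y, hy, hyx⟩ : π₁ x ∈ π₂.ker.map π₁ :=
    π₂.ker.map_eq_top_of_not_le_ker h₁ hle ▸ Subgroup.mem_top _
  have h3 : x * y⁻¹ ∈ π₂.ker := h (by rw [MonoidHom.mem_ker, map_mul, map_inv, hyx, mul_inv_cancel])
  have h4 := π₂.ker.mul_mem h3 hy
  rw [inv_mul_cancel_right] at h4
  exact hk h4

theorem pi_conjQuotient_surjective [Finite ι]
    (hg : Function.Bijective fun i => (g i : G ⧸ conjStabilizer N))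
    (hK : IsNonabelian (M ⧸ N)) :
    Function.Surjective (MonoidHom.pi fun i => conjQuotient N (g i)) := by
  refine MonoidHom.pi_surjective_of_isSimpleGroup hK _ (fun i => conjQuotient_surjective N _)
    fun i j hij => hg.1 ?_
  have heq := le_antisymm hij (MonoidHom.ker_le_ker_of_isSimpleGroup
    (conjQuotient_surjective N (g i)) (conjQuotient_surjective N (g j)) hij)
  rw [ker_conjQuotient, ker_conjQuotient] at heq
  change (g i : G ⧸ conjStabilizer N) = (g j : G ⧸ conjStabilizer N)
  rw [QuotientGroup.eq, mem_conjStabilizer, map_mul, map_inv, mul_smul, inv_smul_eq_iff]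
  exact heq.symm

end ConjugateQuotients

/-! ### The component action on the cosets of `NA` -/

section Component

variable {P M : Type*} [Group P] [Group M] (j : M →* P) (N : Subgroup M) (A : Subgroup P)

/-- The stabilizer of a point in the coset action obtained from `N` and the point
stabilizer `A`. -/
abbrev componentStabilizer : Subgroup P := N.map j ⊔ A

theorem map_le_ker_toPermHom_component [(N.map j).Normal] :
    N.map j ≤ (MulAction.toPermHom P (P ⧸ componentStabilizer j N A)).ker := by
  rw [← Subgroup.normalCore_eq_ker]
  exact Subgroup.normal_le_normalCore.2 le_sup_left

/-- The image of `M` in the permutation group induced on a component. -/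
def componentHom : M →* (MulAction.toPermHom P (P ⧸ componentStabilizer j N A)).range :=
  (MulAction.toPermHom P (P ⧸ componentStabilizer j N A)).rangeRestrict.comp j

theorem componentHom_smul (x : M) (γ : P ⧸ componentStabilizer j N A) :
    componentHom j N A x • γ = j x • γ :=
  rfl

theorem exists_componentHom_smul_eq (hA : ∀ p : P, ∃ x : M, ∃ a ∈ A, p = j x * a)
    (γ : P ⧸ componentStabilizer j N A) :
    ∃ x : M, componentHom j N A x • ((1 : P) : P ⧸ componentStabilizer j N A) = γ := by
  obtain ⟨p, rfl⟩ := QuotientGroup.mk_surjective γ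
  obtain ⟨x, a, ha, rfl⟩ := hA p
  refine ⟨x, ?_⟩
  rw [componentHom_smul]
  change ((j x * 1 : P) : P ⧸ componentStabilizer j N A) = _
  rw [mul_one, QuotientGroup.eq, inv_mul_cancel_left]
  exact (le_sup_right : A ≤ _) ha

/-- `N` has finite index in `NA` because `A` is finite; a finite coset space would then give `N`
finite index in `M`. -/
theorem infinite_component [(N.map j).Normal] (hj : Function.Injective j) [Finite A] [N.Normal]
    [Infinite (M ⧸ N)] :
    Infinite (P ⧸ componentStabilizer j N A) := by
  by_contra hfin
  rw [not_infinite_iff_finite] at hfin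
  have h1 : (componentStabilizer j N A).FiniteIndex := Subgroup.finiteIndex_of_finite_quotient
  have h2 : (N.map j).relIndex (componentStabilizer j N A) ≠ 0 := by
    rw [Subgroup.relIndex_sup_left]
    exact Subgroup.FiniteIndex.index_ne_zero
  have h3 : (N.map j).FiniteIndex := ⟨by
    rw [← Subgroup.relIndex_mul_index (le_sup_left : N.map j ≤ componentStabilizer j N A)]
    exact mul_ne_zero h2 h1.index_ne_zero⟩
  have h4 : N.FiniteIndex := by
    rw [← Subgroup.comap_map_eq_self_of_injective hj N]
    refine ⟨?_⟩
    rw [Subgroup.index_comap]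
    exact Subgroup.FiniteIndex.index_ne_zero (H := (N.map j).subgroupOf j.range)
  have : Finite (M ⧸ N) := Subgroup.finite_quotient_of_finiteIndex
  exact not_finite (M ⧸ N)

/-- `N` acts trivially, being normal in `P` and inside a point stabilizer. By simplicity the kernel
is `N` or `M`, and `M` is transitive on an infinite set. -/
theorem ker_componentHom [(N.map j).Normal] (hA : ∀ p : P, ∃ x : M, ∃ a ∈ A, p = j x * a) [N.Normal]
    [hs : IsSimpleGroup (M ⧸ N)] [Infinite (P ⧸ componentStabilizer j N A)] :
    (componentHom j N A).ker = N := by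
  have hle : N ≤ (componentHom j N A).ker := fun x hx => by
    have h := map_le_ker_toPermHom_component j N A (Subgroup.mem_map_of_mem j hx)
    exact Subtype.ext h
  refine le_antisymm ?_ hle
  rcases hs.eq_bot_or_eq_top_of_normal ((componentHom j N A).ker.map (QuotientGroup.mk' N))
    ((MonoidHom.normal_ker _).map _ (QuotientGroup.mk'_surjective N)) with h | h
  · rw [Subgroup.map_eq_bot_iff, QuotientGroup.ker_mk'] at h
    exact h
  · exfalso
    have htop : ∀ x, componentHom j N A x = 1 := fun x => by
      obtain ⟨y, hy, hyx⟩ : QuotientGroup.mk' N x ∈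
        (componentHom j N A).ker.map (QuotientGroup.mk' N) := h ▸ Subgroup.mem_top _
      have h1 := hle (QuotientGroup.eq.1 hyx)
      have h2 := (componentHom j N A).ker.mul_mem hy h1
      rwa [mul_inv_cancel_left] at h2
    have hsub : Subsingleton (P ⧸ componentStabilizer j N A) :=
      subsingleton_of_forall_eq ((1 : P) : P ⧸ componentStabilizer j N A) fun γ => by
        obtain ⟨x, rfl⟩ := exists_componentHom_smul_eq j N A hA γ
        rw [htop, one_smul]
    exact not_subsingleton (P ⧸ componentStabilizer j N A) hsub

/-- The preimage of the stabilizer is `NA` and `N` acts trivially, so the stabilizer is covered by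
the image of `A`. -/
theorem finite_stabilizer_component [(N.map j).Normal] [Finite A] :
    Finite (MulAction.stabilizer (MulAction.toPermHom P (P ⧸ componentStabilizer j N A)).range
      ((1 : P) : P ⧸ componentStabilizer j N A)) := by
  let τ := MulAction.toPermHom P (P ⧸ componentStabilizer j N A)
  have h : (MulAction.stabilizer τ.range ((1 : P) : P ⧸ componentStabilizer j N A) : Set τ.range) ⊆
      Set.range fun a : A => τ.rangeRestrict a := by
    rintro ⟨_, p, rfl⟩ hp
    have hp' : ((p * 1 : P) : P ⧸ componentStabilizer j N A) = ((1 : P) : P ⧸ _) := hp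
    rw [mul_one, eq_comm, QuotientGroup.eq, inv_one, one_mul, ← SetLike.mem_coe,
      Subgroup.normal_mul] at hp'
    obtain ⟨n, hn, a, ha, rfl⟩ := hp'
    refine ⟨⟨a, ha⟩, Subtype.ext ?_⟩
    have hn' : τ n = 1 := map_le_ker_toPermHom_component j N A hn
    change τ a = τ (n * a)
    rw [map_mul, hn', one_mul]
  exact (Set.finite_range _).subset h

theorem normal_range_componentHom (hj : j.range.Normal) :
    (componentHom j N A).range.Normal := by
  rw [componentHom, MonoidHom.range_comp]
  exact hj.map _ (MonoidHom.rangeRestrict_surjective _)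

end Component

/-! ### Product decomposition and the main theorem -/

/-- A nonabelian simple normal subgroup of an infinite primitive group with a finite point
stabilizer is its unique minimal normal subgroup, has finite index, and the whole group is almost
simple over it. -/
theorem IsInfinitePrimitiveWithFiniteStabilizer.of_normal_isSimpleGroup {Γ : Type*}
    {H : Subgroup (Equiv.Perm Γ)} (hH : IsInfinitePrimitiveWithFiniteStabilizer H)
    (L : Subgroup H) [hL : L.Normal] [hs : IsSimpleGroup L] (hna : IsNonabelian L) :
    IsUniqueMinimalNormal L ∧ L.FiniteIndex ∧ IsAlmostSimpleOver L := by
  obtain ⟨hinf, hprim, γ, hfin⟩ := hH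
  have hLbot : L ≠ ⊥ := L.nontrivial_iff_ne_bot.1 inferInstance
  obtain ⟨M, hM, hMbot, hleast⟩ := exists_least_normal (G := H) γ
  have hML : M = L := by
    refine le_antisymm (hleast L hL hLbot) ?_
    rw [← Subgroup.subgroupOf_eq_top]
    refine (hs.eq_bot_or_eq_top_of_normal (M.subgroupOf L) inferInstance).resolve_left fun h => ?_
    rw [Subgroup.subgroupOf_eq_bot] at h
    exact hMbot (h.eq_bot_of_le (hleast L hL hLbot))
  subst hML
  have := M.isPretransitive_of_normal_of_ne_bot (Ω := Γ) hMbot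
  exact ⟨isUniqueMinimalNormal_of_least hM hMbot hleast, M.finiteIndex_of_isPretransitive γ,
    hM, hs, hna, MulAut.conjNormal, conjNormal_injective_of_least hleast hna, fun _ _ => rfl⟩

theorem IsNonabelian.of_mulEquiv {G H : Type*} [Group G] [Group H] (h : IsNonabelian G)
    (e : G ≃* H) : IsNonabelian H := by
  obtain ⟨a, b, hab⟩ := h
  exact ⟨e a, e b, fun h => hab (e.injective (by simpa using h))⟩

/-- The product action decomposition of a primitive group relative to a transitive normal
subgroup that is a non-regular power of a simple group. -/
theorem exists_productAction {G Ω : Type u} [Group G] [MulAction G Ω] [FaithfulSMul G Ω]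
    [MulAction.IsPreprimitive G Ω] (α : Ω) [Finite (MulAction.stabilizer G α)]
    (M : Subgroup G) [M.Normal] [MulAction.IsPretransitive M Ω]
    (N : Subgroup M) [N.Normal] [IsSimpleGroup (M ⧸ N)] [Infinite (M ⧸ N)]
    (hK : IsNonabelian (M ⧸ N)) {ι : Type*} [Nonempty ι] {g : ι → G}
    (hg : Function.Bijective fun i => (g i : G ⧸ conjStabilizer N))
    (hgα : ∀ i, g i ∈ MulAction.stabilizer G α)
    (hbij : Function.Bijective (MonoidHom.pi fun i => conjQuotient N (g i)))
    (hreg : ¬ ActsRegularly M Ω) :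
    ∃ (Γ : Type u) (H : Subgroup (Equiv.Perm Γ)) (L : Subgroup H),
      Infinite Γ ∧ IsInfinitePrimitiveWithFiniteStabilizer H ∧ IsUniqueMinimalNormal L ∧
      IsAlmostSimpleType H L ∧ Nonempty (L ≃* M ⧸ N) ∧
      ∃ S : Subgroup (WreathProduct H ι), PermutationIsomorphic G Ω S (ι → Γ) := by
  let P := conjStabilizer N
  have hMP : M ≤ P := le_conjStabilizer N
  let j : M →* P := Subgroup.inclusion hMP
  have hj : Function.Injective j := Subgroup.inclusion_injective hMP
  let A : Subgroup P := (MulAction.stabilizer G α).subgroupOf P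
  have hAfin : Finite A := Finite.of_injective
    (fun a : A => (⟨a.1.1, a.2⟩ : MulAction.stabilizer G α)) fun a b hab =>
      Subtype.ext (Subtype.ext (congrArg (fun x : MulAction.stabilizer G α => (x : G)) hab))
  have hNj : (N.map j).Normal := by
    refine ⟨?_⟩
    rintro _ ⟨y, hy, rfl⟩ p
    exact ⟨MulAut.conjNormal (p : G) y, (conj_mem_map_iff_of_mem_conjStabilizer p.2 y).2 hy, rfl⟩
  have hjr : j.range.Normal := by
    have : j.range = M.subgroupOf P := Subgroup.inclusion_range hMP
    rw [this]
    infer_instance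
  have hA : ∀ p : P, ∃ x : M, ∃ a ∈ A, p = j x * a := by
    intro p
    obtain ⟨x, hx, a, ha, hpa⟩ := M.exists_mul_mem_stabilizer α (p : G)
    have haP : a ∈ P := by
      have := P.mul_mem (P.inv_mem (hMP hx)) p.2
      rwa [hpa, inv_mul_cancel_left] at this
    exact ⟨⟨x, hx⟩, ⟨a, haP⟩, ha, Subtype.ext hpa⟩
  let Γ := P ⧸ componentStabilizer j N A
  let γ₀ : Γ := ((1 : P) : P ⧸ componentStabilizer j N A)
  let H := (MulAction.toPermHom P Γ).range
  let ρ : P →* H := (MulAction.toPermHom P Γ).rangeRestrict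
  let l : M →* H := componentHom j N A
  have hΓ : Infinite Γ := infinite_component j N A hj
  have hker : l.ker = N := ker_componentHom j N A hA
  have htrans : ∀ γ : Γ, ∃ x : M, l x • γ₀ = γ := exists_componentHom_smul_eq j N A hA
  have hHtrans : MulAction.IsPretransitive H Γ := by
    rw [MulAction.isPretransitive_iff_base γ₀]
    exact fun γ => (htrans γ).imp' l fun _ h => h
  have hHinf : Infinite H := by
    by_contra hf
    rw [not_infinite_iff_finite] at hf
    have : Finite Γ := Finite.of_surjective (fun h : H => h • γ₀) fun γ =>
      (htrans γ).imp' l fun _ h => h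
    exact not_finite Γ
  have hconj : ∀ (x : M) (i : ι), (g i)⁻¹ * (x : G) * g i ∈ P := fun x i =>
    hMP (by simpa using ‹M.Normal›.conj_mem x x.2 (g i)⁻¹)
  have hWM : ∀ (x : M) (f : ι → Γ) (i : ι),
      (wreathHom P hg ρ x • f) i = l (MulAut.conjNormal (g i)⁻¹ x) • f i := by
    intro x f i
    rw [wreathHom_smul_apply_of_conj_mem P hg ρ (hconj x)]
    have h : (⟨_, hconj x i⟩ : P) = j (MulAut.conjNormal (g i)⁻¹ x) := Subtype.ext (by simp [j])
    rw [h]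
    rfl
  -- As the representatives lie in `G_α`, the base coordinates of an element of `G_α` come from `A`
  -- and fix `γ₀`. For transitivity, `hbij` provides one element of `M` with prescribed action in
  -- every coordinate.
  obtain ⟨e, he⟩ := MulAction.IsPreprimitive.exists_equivariant_equiv (wreathHom P hg ρ) α
    (fun _ : ι => γ₀) (by
      intro a ha
      funext i
      rw [wreathHom_smul_apply]
      change (((_ : P) * 1 : P) : P ⧸ componentStabilizer j N A) = _
      rw [mul_one, eq_comm, QuotientGroup.eq, inv_one, one_mul]
      refine (le_sup_right : A ≤ componentStabilizer j N A) ?_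
      exact mul_mem (mul_mem (inv_mem (hgα _)) ha) (hgα _)) (by
      intro y
      choose z hz using fun i => htrans (y i)
      obtain ⟨x, hx⟩ := hbij.2 fun i => (z i : M ⧸ N)
      refine ⟨x, funext fun i => ?_⟩
      have h1 : l (MulAut.conjNormal (g i)⁻¹ x) = l (z i) := by
        have h2 : (MulAut.conjNormal (g i)⁻¹ x)⁻¹ * z i ∈ l.ker := by
          rw [hker]
          exact QuotientGroup.eq.1 (congrFun hx i)
        rw [MonoidHom.mem_ker, map_mul, map_inv, inv_mul_eq_one] at h2
        exact h2
      rw [hWM, h1, hz])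
  have hprim : MulAction.IsPreprimitive H Γ :=
    MulAction.IsPreprimitive.of_wreathProduct (wreathHom P hg ρ) e he
  have hH : IsInfinitePrimitiveWithFiniteStabilizer H :=
    ⟨hHinf, hprim, γ₀, finite_stabilizer_component j N A⟩
  let L : Subgroup H := l.range
  have hLn : L.Normal := normal_range_componentHom j N A hjr
  let eL : L ≃* M ⧸ N := (QuotientGroup.quotientKerEquivRange l).symm.trans
    (QuotientGroup.quotientMulEquivOfEq hker)
  have hLs : IsSimpleGroup L := eL.isSimpleGroup
  obtain ⟨h1, h2, h3⟩ := hH.of_normal_isSimpleGroup L (hK.of_mulEquiv eL.symm)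
  -- If `L` were regular, an element of `M` fixing `ω` would be trivial in each coordinate, so `M`
  -- would be regular.
  refine ⟨Γ, H, L, hΓ, hH, h1, ⟨hLs, fun hr => hreg ⟨inferInstance, fun ω => ?_⟩, h2, h3⟩, ⟨eL⟩,
    exists_permutationIsomorphic (wreathHom P hg ρ) e he⟩
  rw [Subgroup.eq_bot_iff_forall]
  intro x hx
  refine (injective_iff_map_eq_one _).1 hbij.1 x (funext fun i => ?_)
  have h4 : wreathHom P hg ρ x • e ω = e ω := by
    rw [← he]
    exact congrArg e hx
  have h5 := congrFun h4 i
  rw [hWM] at h5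
  have h6 : (⟨l (MulAut.conjNormal (g i)⁻¹ x), _, rfl⟩ : L) ∈ MulAction.stabilizer L (e ω i) := h5
  rw [hr.2, Subgroup.mem_bot] at h6
  have h7 : MulAut.conjNormal (g i)⁻¹ x ∈ l.ker := congrArg Subtype.val h6
  rw [hker] at h7
  exact (QuotientGroup.eq_one_iff _).2 h7

theorem theorem1 {Ω : Type u} (G : Subgroup (Equiv.Perm Ω)) (hinf : Infinite G)
    (hprim : MulAction.IsPreprimitive G Ω) (α : Ω)
    (hfin : Finite (MulAction.stabilizer G α)) :
    (∃ S : Finset G, (∀ s ∈ S, IsOfFinOrder s) ∧ Subgroup.closure (S : Set G) = ⊤) ∧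
    ∃ M : Subgroup G, IsUniqueMinimalNormal M ∧
      ∃ (K : Type u) (_ : Group K) (m : ℕ),
        Infinite K ∧ IsNonabelian K ∧ Group.FG K ∧ IsSimpleGroup K ∧
        1 ≤ m ∧ Nonempty (M ≃* (Fin m → K)) ∧
        ExactlyOne (IsSplitExtensionType G M α) (IsAlmostSimpleType G M)
          (IsProductActionType G M K m) := by
  obtain ⟨S, hS, hSG⟩ := exists_finset_isOfFinOrder_closure_eq_top (G := G) α
  refine ⟨⟨S, hS, hSG⟩, ?_⟩
  have hGfg : Group.FG G := Group.fg_iff.2 ⟨S, hSG, S.finite_toSet⟩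
  obtain ⟨M, hM, hMbot, hleast⟩ := exists_least_normal (G := G) α
  have hMt := M.isPretransitive_of_normal_of_ne_bot (Ω := Ω) hMbot
  have hMfi := M.finiteIndex_of_isPretransitive α
  have hMinf : Infinite M := by
    by_contra hf
    rw [not_infinite_iff_finite] at hf
    have := FaithfulSMul.infinite_of_infinite_group G Ω
    have : Finite Ω := Finite.of_surjective (fun x : M => x • α) (MulAction.exists_smul_eq M α)
    exact not_finite Ω
  -- Finite generation of `M` is inferred from its finite index in `G`.
  have hMna : IsNonabelian M := isNonabelian_of_least hleast
  obtain ⟨N, hN, hNs⟩ := exists_normal_isSimpleGroup_quotient M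
  obtain ⟨m, hm, g, hgα, hg⟩ := exists_conjStabilizer_representatives N
    (MulAction.stabilizer G α) (M.exists_mul_mem_stabilizer α)
  have hinj := pi_conjQuotient_injective N hg hleast
  have hK := isNonabelian_quotient_of_least N hg hleast hMna
  have hsurj := pi_conjQuotient_surjective N hg hK
  have hKinf : Infinite (M ⧸ N) := by
    by_contra hf
    rw [not_infinite_iff_finite] at hf
    have : Finite M := Finite.of_injective _ hinj
    exact not_finite M
  have hconj := conjNormal_injective_of_least hleast hMna
  have hKfg : Group.FG (M ⧸ N) := Group.fg_of_surjective (QuotientGroup.mk'_surjective N)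
  let e : M ≃* (Fin m → M ⧸ N) := MulEquiv.ofBijective _ ⟨hinj, hsurj⟩
  refine ⟨M, isUniqueMinimalNormal_of_least hM hMbot hleast, M ⧸ N, inferInstance, m, hKinf, hK,
    hKfg, hNs, hm, ⟨e⟩, ?_, fun h => h.2.not_regular h.1.regular,
    fun h => h.2.not_regular h.1.regular, fun h => h.2.not_simple h.1.simple⟩
  by_cases hreg : ActsRegularly M Ω
  · have hdisj : ∀ x ∈ M, x ∈ MulAction.stabilizer G α → x = 1 := fun x hx hxα => by
      have h1 : (⟨x, hx⟩ : M) ∈ MulAction.stabilizer M α := hxα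
      rw [hreg.2, Subgroup.mem_bot] at h1
      exact congrArg Subtype.val h1
    refine Or.inl ⟨hreg, hM, ?_, ?_⟩
    · refine Subgroup.isComplement'_of_disjoint_and_mul_eq_univ ?_ ?_
      · rw [Subgroup.disjoint_def]
        exact fun {x} hx hxα => hdisj x hx hxα
      · rw [Set.eq_univ_iff_forall]
        intro x
        obtain ⟨y, hy, a, ha, rfl⟩ := M.exists_mul_mem_stabilizer α x
        exact Set.mul_mem_mul hy ha
    · rintro a ha ⟨x, hx⟩
      -- Conjugation on `M` is faithful on `G`, so an element of `G_α` acting as `x` equals `x` and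
      -- lies in `M ∩ G_α = 1`.
      have h1 : a = x := hconj (MulEquiv.ext fun y => Subtype.ext (hx y))
      exact hdisj a (h1 ▸ x.2) ha
  · by_cases hs : IsSimpleGroup M
    · exact Or.inr (Or.inl ⟨hs, hreg, hMfi, hM, hs, hMna, MulAut.conjNormal, hconj,
        fun _ _ => rfl⟩)
    · have hne : Nonempty (Fin m) := ⟨⟨0, hm⟩⟩
      refine Or.inr (Or.inr ⟨hreg, hs, lt_of_le_of_ne hm ?_,
        exists_productAction α M N hK hg hgα ⟨hinj, hsurj⟩ hreg⟩)
      rintro rfl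
      exact hs (e.trans (MulEquiv.funUnique (Fin 1) (M ⧸ N))).isSimpleGroup
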